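/- Let $G=(V,E)$ be a finite, simple, undirected, connected, non-bipartite graph with $n$ nodes (resources), let $m$ users be allocated to the nodes, and let every node $v$ have a threshold $T_v\in\mathbb N$ that is the same for all users. For a state $a\in V^m$ let $x_v=|\{i: a_i=v\}|$ be the load of $v$, $\Phi_v(x)=\max\{x_v-T_v,0\}$ and $\Phi(x)=\sum_{v}\Phi_v(x)$. Let $0<\alpha\le 1/2$ (for example $\alpha=1/(2e)$). In each round of the user-controlled protocol every user, independently of the others, leaves its current resource $v$ with probability $\alpha\,\Phi_v(x)/x_v$, where $x$ is the current profile; a user that leaves moves to a uniformly random neighbour of $v$. Let $\mathbf P$ be the transition matrix of the lazy random walk on $G$ that stays put with probability $1-\alpha$ and otherwise moves to a uniformly random neighbour, let $\mu=1-\max\{|\lambda| : \lambda \text{ an eigenvalue of } \mathbf P,\ |\lambda|<1\}$, let $\mathsf{MIX}(G)=4\log n/\mu$ (natural logarithm), and let $\pi(v)=\deg(v)/(2|E|)$. For $M\ge 0$ put $\lambda(M)=8\max\{\sqrt{2M\log n},\,4\log n\}$. Suppose that the process starts in an arbitrary state with profile $x^0$, and let $x^t$ be the profile after $t=\lceil\mathsf{MIX}(G)\rceil$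 rounds. (1) If $G$ is regular, then with probability at least $1-3n^{-1}$ every resource $v$ satisfies $$\Phi_v(x^t)\le M+\lambda(M)+\frac{294}{1-\alpha}\log^2 n\;\mathsf{MIX}(G)^2,\qquad M=\frac{\Phi(x^0)}{n}\,(1+n^{-2}).$$ (2) In general (whether or not $G$ is regular), with probability at least $1-2n^{-1}$ every resource $v$ satisfies $$\Phi_v(x^t)\le M_v+\lambda(M_v)+\frac{294}{1-\alpha}\,n\log^2 n\;\mathsf{MIX}(G)^2,\qquad M_v=\Phi(x^0)\,(\pi(v)+n^{-3}).$$ -/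

import Mathlib

noncomputable section

namespace ThresholdBalancing

variable {V : Type*} [Fintype V] [DecidableEq V]

/-! ### Random walks on graphs -/

/-- Transition matrix of the simple random walk on `G`. -/
def walkMatrix (G : SimpleGraph V) [DecidableRel G.Adj] : Matrix V V ℝ :=
  fun u v => if G.Adj u v then 1 / (G.degree u : ℝ) else 0

/-- Transition matrix of the lazy random walk on `G` with loop probability `1 - α`. -/
def lazyWalkMatrix (G : SimpleGraph V) [DecidableRel G.Adj] (α : ℝ) : Matrix V V ℝ :=
  (1 - α) • (1 : Matrix V V ℝ) + α • walkMatrix G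

/-- The quantity `μ`: one minus the largest absolute value, among those smaller than one,
of an eigenvalue. -/
def eigenGap (M : Matrix V V ℝ) : ℝ :=
  1 - sSup {r : ℝ | ∃ l : ℝ, Module.End.HasEigenvalue (Matrix.toLin' M) l ∧ |l| < 1 ∧ r = |l|}

/-- The mixing time `4 log n / μ` of the lazy random walk with loop probability `1 - α`. -/
def mixingTime (G : SimpleGraph V) [DecidableRel G.Adj] (α : ℝ) : ℝ :=
  4 * Real.log (Fintype.card V) / eigenGap (lazyWalkMatrix G α)

/-- The stationary distribution `π(v) = deg(v) / (2|E|)`. -/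
def stationary (G : SimpleGraph V) [DecidableRel G.Adj] (v : V) : ℝ :=
  (G.degree v : ℝ) / (2 * (G.edgeFinset.card : ℝ))

/-! ### States and potential -/

/-- The load `x_v`: the number of users that the state `a` assigns to `v`. -/
def load {m : ℕ} (a : Fin m → V) (v : V) : ℕ :=
  (Finset.univ.filter fun i => a i = v).card

/-- `Φ_v = max (x_v - T_v) 0`; the subtraction of natural numbers truncates at zero. -/
def nodePotential {m : ℕ} (T : V → ℕ) (a : Fin m → V) (v : V) : ℕ :=
  load a v - T v

/-- `Φ = ∑ v, Φ_v`. -/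
def potential {m : ℕ} (T : V → ℕ) (a : Fin m → V) : ℕ :=
  ∑ v, nodePotential T a v

/-! ### The user-controlled protocol -/

/-- The probability with which a user on `v` migrates in one round. -/
def migrationProb {m : ℕ} (T : V → ℕ) (α : ℝ) (a : Fin m → V) (v : V) : ℝ :=
  α * ((nodePotential T a v : ℝ) / (load a v : ℝ))

/-- The probability that user `i` is on `w` after one round that starts in the state `a`:
it stays with probability `1 - p` and moves to a uniformly random neighbour with
probability `p`, where `p` is the migration probability on its current resource. -/
def userStep {m : ℕ} (G : SimpleGraph V) [DecidableRel G.Adj] (T : V → ℕ) (α : ℝ)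
    (a : Fin m → V) (i : Fin m) (w : V) : ℝ :=
  (1 - migrationProb T α a (a i)) * (if w = a i then 1 else 0)
    + migrationProb T α a (a i) * walkMatrix G (a i) w

/-- Transition matrix of one round: given the current state, all users act independently. -/
def roundMatrix (m : ℕ) (G : SimpleGraph V) [DecidableRel G.Adj] (T : V → ℕ) (α : ℝ) :
    Matrix (Fin m → V) (Fin m → V) ℝ :=
  fun a b => ∏ i, userStep G T α a i (b i)

open Classical in
/-- The probability that the state after `t` rounds lies in `S`, for the Markov chain of the
protocol started in the state `a`. -/
def probAfter {m : ℕ} (G : SimpleGraph V) [DecidableRel G.Adj] (T : V → ℕ) (α : ℝ)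
    (a : Fin m → V) (t : ℕ) (S : Set (Fin m → V)) : ℝ :=
  ∑ b with b ∈ S, (roundMatrix m G T α ^ t) a b

/-- The deviation term `8 max {√(2 M log n), 4 log n}` that belongs to the leading term `M`. -/
def deviation (n : ℕ) (M : ℝ) : ℝ :=
  8 * max (Real.sqrt (2 * M * Real.log n)) (4 * Real.log n)

/-! ### One round is a stochastic matrix -/

theorem migrationProb_nonneg {m : ℕ} (T : V → ℕ) {α : ℝ} (h0 : 0 ≤ α) (a : Fin m → V) (v : V) :
    0 ≤ migrationProb T α a v := by
  unfold migrationProb; positivity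

theorem migrationProb_le {m : ℕ} (T : V → ℕ) {α : ℝ} (h0 : 0 ≤ α) (a : Fin m → V) (v : V) :
    migrationProb T α a v ≤ α := by
  unfold migrationProb
  have h : (nodePotential T a v : ℝ) / (load a v : ℝ) ≤ 1 := by
    apply div_le_one_of_le₀ _ (Nat.cast_nonneg _)
    exact_mod_cast Nat.sub_le _ _
  nlinarith

theorem walkMatrix_row_sum (G : SimpleGraph V) [DecidableRel G.Adj] (u : V)
    (hu : 0 < G.degree u) : ∑ v, walkMatrix G u v = 1 := by
  have hu' : (G.degree u : ℝ) ≠ 0 := by exact_mod_cast hu.ne'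
  unfold walkMatrix
  rw [← Finset.sum_filter, Finset.sum_const, nsmul_eq_mul]
  have : (Finset.univ.filter fun v => G.Adj u v).card = G.degree u := by
    rw [← SimpleGraph.card_neighborFinset_eq_degree, SimpleGraph.neighborFinset_eq_filter]
  rw [this]
  field_simp

theorem roundMatrix_nonneg {m : ℕ} (G : SimpleGraph V) [DecidableRel G.Adj] (T : V → ℕ) {α : ℝ}
    (h0 : 0 ≤ α) (h1 : α ≤ 1) (a b : Fin m → V) : 0 ≤ roundMatrix m G T α a b := by
  apply Finset.prod_nonneg
  intro i _
  have hp := migrationProb_nonneg T h0 a (a i)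
  have hq := (migrationProb_le T h0 a (a i)).trans h1
  have hw : 0 ≤ walkMatrix G (a i) (b i) := by unfold walkMatrix; split_ifs <;> positivity
  unfold userStep
  have h2 : 0 ≤ 1 - migrationProb T α a (a i) := by linarith
  split_ifs <;> positivity

theorem roundMatrix_row_sum {m : ℕ} (G : SimpleGraph V) [DecidableRel G.Adj] (T : V → ℕ) (α : ℝ)
    (hG : ∀ v, 0 < G.degree v) (a : Fin m → V) : ∑ b, roundMatrix m G T α a b = 1 := by
  have key : ∀ i, ∑ w, userStep G T α a i w = 1 := by
    intro i
    unfold userStep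
    rw [Finset.sum_add_distrib, ← Finset.mul_sum, ← Finset.mul_sum,
      walkMatrix_row_sum G _ (hG _)]
    simp
  unfold roundMatrix
  rw [← Fintype.prod_sum fun i w => userStep G T α a i w]
  simp [key]

end ThresholdBalancing

end

open ThresholdBalancing

namespace ThresholdBalancing

/-! ### Exponential moments of the potential under the protocol -/

section Round

variable {V : Type*} [Fintype V] [DecidableEq V] {m : ℕ}

/-! Excess load moves roughly like the lazy walk `P`: an expected `α Φ_v` users leave `v`, each to a
random neighbour. The proof makes this precise for exponential moments, and so avoids step-by-step
concentration. In one round, an exponent vector `h` with values in `[0, 1/20]` is replaced by `P h`,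
at the price of a factor `exp (∑ h_v)` (`sum_roundMatrix_mul_exp_le`).

Two errors must be absorbed. The second-order term of the exponential would accumulate over rounds;
using the exponents `tilt h = h - 2h²` instead of `h` lets the Jensen gap of this concave function
pay for it (`tilt_lazyWalk`, which needs `α ≤ 1/2`). Truncation of the potential at zero matters
when more users leave a node than its potential; this adds at most `tilt (h v)` in expectation to
the factor of `v`, whence the price.

Starting from `h = c δ_v` and iterating `t` rounds leaves the exponent `c P^t(u,v)` on the initial
potential of `u`, and a total price of `c` times the sum of the column sums of `P^s`, `s < t`. These
column sums are 1 for regular graphs and at most `n` always. Spectral theory gives `P^t(u,v) ≤ π(v)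
+ n⁻³` at the mixing time. Markov's inequality with a suitable `c` bounds the failure probability at
each node by `n⁻²`, and a union bound over the nodes gives `1/n`, which is stronger than both
claims. -/

theorem nodePotential_le_departures_arrivals (T : V → ℕ) (a b : Fin m → V) (v : V) :
    nodePotential T b v ≤
      (nodePotential T a v - (Finset.univ.filter fun i => a i = v ∧ b i ≠ v).card)
        + (Finset.univ.filter fun i => a i ≠ v ∧ b i = v).card := by
  have h1 : load a v = (Finset.univ.filter fun i => a i = v ∧ b i = v).card
      + (Finset.univ.filter fun i => a i = v ∧ b i ≠ v).card := by
    unfold load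
    rw [← Finset.card_filter_add_card_filter_not (s := Finset.univ.filter fun i => a i = v)
      (fun i => b i = v), Finset.filter_filter, Finset.filter_filter]
  have h2 : load b v = (Finset.univ.filter fun i => a i = v ∧ b i = v).card
      + (Finset.univ.filter fun i => a i ≠ v ∧ b i = v).card := by
    unfold load
    rw [← Finset.card_filter_add_card_filter_not (s := Finset.univ.filter fun i => b i = v)
      (fun i => a i = v), Finset.filter_filter, Finset.filter_filter]
    simp only [and_comm, ne_eq]
  unfold nodePotential
  omega

/-- Weight of a move of a user from `v` to `w` in the exponential moment of the potential. -/
noncomputable def moveWeight (θ : V → ℝ) (v w : V) : ℝ := if w = v then 1 else Real.exp (θ w - θ v)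

/-- Weight of a move from `v` to `w` when more users leave `v` than its potential. -/
noncomputable def surplusWeight (θ : V → ℝ) (v w : V) : ℝ := if w = v then 1 else Real.exp (1 + θ w)

/-- If `l > p`, the first exponential falls short of its truncated value 1 by at most `θ (l - p)`,
which `θ exp (l - p)` covers. Both terms on the right are exponentials linear in `l`, so they factor
over users; the truncated one does not. -/
theorem exp_truncated_le {θ : ℝ} (hθ : 0 ≤ θ) (S : ℝ) (p l : ℕ) :
    Real.exp (θ * ((p - l : ℕ) : ℝ) + S) ≤
      Real.exp (θ * (p - l) + S) + θ * Real.exp (l - p + S) := by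
  rcases le_total l p with h | h
  · rw [Nat.cast_sub h]
    have := Real.exp_pos ((l : ℝ) - p + S)
    have := mul_nonneg hθ this.le
    linarith
  · rw [Nat.sub_eq_zero_of_le h]
    have h' : (0 : ℝ) ≤ (l : ℝ) - p := by
      have : (p : ℝ) ≤ l := by exact_mod_cast h
      linarith
    have e1 := Real.add_one_le_exp (θ * ((p : ℝ) - l))
    have e2 := Real.add_one_le_exp ((l : ℝ) - p)
    have e3 : θ * ((l : ℝ) - p) ≤ θ * Real.exp ((l : ℝ) - p) :=
      mul_le_mul_of_nonneg_left (by linarith) hθ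
    have : 1 ≤ Real.exp (θ * ((p : ℝ) - l)) + θ * Real.exp ((l : ℝ) - p) := by linarith
    have := mul_le_mul_of_nonneg_right this (Real.exp_pos S).le
    rw [Real.exp_add _ S, Real.exp_add _ S, Real.exp_add _ S]
    simp only [Nat.cast_zero, mul_zero, Real.exp_zero]
    linarith

theorem exp_potential_le (T : V → ℕ) (a b : Fin m → V) (θ : V → ℝ) (hθ : ∀ v, 0 ≤ θ v) :
    Real.exp (∑ v, θ v * nodePotential T b v) ≤
      ∏ v, (Real.exp (θ v * nodePotential T a v) *
          ∏ i with a i = v, moveWeight θ v (b i)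
        + θ v * Real.exp (-(nodePotential T a v : ℝ)) *
          ∏ i with a i = v, surplusWeight θ v (b i)) := by
  set L : V → ℕ := fun v => (Finset.univ.filter fun i => a i = v ∧ b i ≠ v).card with hL
  set S : V → ℝ := fun v => ∑ i with a i = v, if b i = v then 0 else θ (b i) with hS
  have hLsum : ∀ v, (L v : ℝ) = ∑ i with a i = v, if b i = v then (0 : ℝ) else 1 := by
    intro v
    simp only [hL]
    rw [← Finset.filter_filter, Finset.card_filter]
    push_cast
    exact Finset.sum_congr rfl fun i _ => by split_ifs <;> simp_all
  -- Arrivals are charged to the node of origin, so that the bound factors over the nodes of the old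
  -- state.
  have harr : ∑ v, θ v * ((Finset.univ.filter fun i => a i ≠ v ∧ b i = v).card : ℝ)
      = ∑ v, S v := by
    simp only [hS]
    have e1 : ∀ v, (∑ i with a i = v, if b i = v then 0 else θ (b i))
        = ∑ i with a i = v, if b i = a i then 0 else θ (b i) := by
      intro v
      refine Finset.sum_congr rfl fun i hi => ?_
      rw [(Finset.mem_filter.1 hi).2]
    have e2 : ∀ v, θ v * ((Finset.univ.filter fun i => a i ≠ v ∧ b i = v).card : ℝ)
        = ∑ i with b i = v, if b i = a i then 0 else θ (b i) := by
      intro v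
      have : (Finset.univ.filter fun i => a i ≠ v ∧ b i = v)
          = (Finset.univ.filter fun i => b i = v).filter fun i => a i ≠ v := by
        rw [Finset.filter_filter]; simp only [and_comm]
      rw [this, Finset.card_filter]
      push_cast
      rw [Finset.mul_sum]
      refine Finset.sum_congr rfl fun i hi => ?_
      have hi := (Finset.mem_filter.1 hi).2
      by_cases h : a i = v <;> simp_all [eq_comm]
    simp only [e1, e2]
    rw [Finset.sum_fiberwise, Finset.sum_fiberwise]
  have hle : ∑ v, θ v * nodePotential T b v
      ≤ ∑ v, (θ v * ((nodePotential T a v - L v : ℕ) : ℝ) + S v) := by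
    rw [Finset.sum_add_distrib, ← harr, ← Finset.sum_add_distrib]
    refine Finset.sum_le_sum fun v _ => ?_
    rw [← mul_add]
    refine mul_le_mul_of_nonneg_left ?_ (hθ v)
    exact_mod_cast nodePotential_le_departures_arrivals T a b v
  refine (Real.exp_le_exp.2 hle).trans ?_
  rw [Real.exp_sum]
  refine Finset.prod_le_prod (fun v _ => (Real.exp_pos _).le) fun v _ => ?_
  refine (exp_truncated_le (hθ v) (S v) _ _).trans (le_of_eq ?_)
  have m1 : ∏ i with a i = v, moveWeight θ v (b i) = Real.exp (S v - θ v * L v) := by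
    rw [hLsum, Finset.mul_sum, ← Finset.sum_sub_distrib, Real.exp_sum]
    refine Finset.prod_congr rfl fun i _ => ?_
    unfold moveWeight
    split_ifs <;> simp
  have m2 : ∏ i with a i = v, surplusWeight θ v (b i) = Real.exp (L v + S v) := by
    rw [hLsum, ← Finset.sum_add_distrib, Real.exp_sum]
    refine Finset.prod_congr rfl fun i _ => ?_
    unfold surplusWeight
    split_ifs <;> simp
  rw [m1, m2, mul_assoc, ← Real.exp_add, ← Real.exp_add]
  congr 2
  · ring_nf
  · ring_nf

/-- Independence of the users: the expectation of a product over nodes, each factor being a sum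
of two products over the users on that node. -/
theorem sum_prod_mul_prod_add (a : Fin m → V) (q : Fin m → V → ℝ) (k l : V → ℝ)
    (f g : V → V → ℝ) :
    ∑ b : Fin m → V, (∏ i, q i (b i)) *
        ∏ v, (k v * ∏ i with a i = v, f v (b i) + l v * ∏ i with a i = v, g v (b i))
      = ∏ v, (k v * ∏ i with a i = v, ∑ w, q i w * f v w
          + l v * ∏ i with a i = v, ∑ w, q i w * g v w) := by
  -- Writing each two-term sum as a sum over `Bool` expands the product over choices `κ : V → Bool`.
  -- For fixed `κ` the products over nodes and their users merge into one product over all users,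
  -- which independence evaluates.
  set K : V → Bool → ℝ := fun v c => if c then k v else l v
  set F : V → Bool → V → ℝ := fun v c w => if c then f v w else g v w
  have e1 : ∀ b : Fin m → V, ∀ v,
      k v * ∏ i with a i = v, f v (b i) + l v * ∏ i with a i = v, g v (b i)
        = ∑ c : Bool, K v c * ∏ i with a i = v, F v c (b i) := by
    intro b v; simp [K, F]
  have e2 : ∀ v, k v * ∏ i with a i = v, ∑ w, q i w * f v w
          + l v * ∏ i with a i = v, ∑ w, q i w * g v w
        = ∑ c : Bool, K v c * ∏ i with a i = v, ∑ w, q i w * F v c w := by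
    intro v; simp [K, F]
  have fib : ∀ (κ : V → Bool) (h : V → Fin m → ℝ),
      ∏ v, (K v (κ v) * ∏ i with a i = v, h v i) = (∏ v, K v (κ v)) * ∏ i, h (a i) i := by
    intro κ h
    rw [Finset.prod_mul_distrib, ← Finset.prod_fiberwise Finset.univ a fun i => h (a i) i]
    congr 1
    refine Finset.prod_congr rfl fun v _ => Finset.prod_congr rfl fun i hi => ?_
    rw [(Finset.mem_filter.1 hi).2]
  simp only [e1, e2]
  simp only [Fintype.prod_sum]
  simp only [fib, Finset.mul_sum]
  rw [Finset.sum_comm]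
  refine Finset.sum_congr rfl fun κ _ => ?_
  rw [Fintype.prod_sum, Finset.mul_sum]
  refine Finset.sum_congr rfl fun b _ => ?_
  rw [Finset.prod_mul_distrib]
  ring

theorem walkMatrix_nonneg (G : SimpleGraph V) [DecidableRel G.Adj] (u v : V) :
    0 ≤ walkMatrix G u v := by
  unfold walkMatrix; split_ifs <;> positivity

theorem walkMatrix_self (G : SimpleGraph V) [DecidableRel G.Adj] (u : V) :
    walkMatrix G u u = 0 := by
  simp [walkMatrix]

theorem sum_userStep_mul (G : SimpleGraph V) [DecidableRel G.Adj] (T : V → ℕ) (α : ℝ)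
    (a : Fin m → V) (i : Fin m) (f : V → ℝ) :
    ∑ w, userStep G T α a i w * f w
      = (1 - migrationProb T α a (a i)) * f (a i)
        + migrationProb T α a (a i) * ∑ w, walkMatrix G (a i) w * f w := by
  unfold userStep
  simp only [add_mul, Finset.sum_add_distrib, mul_ite, mul_one, mul_zero, ite_mul, zero_mul,
    Finset.sum_ite_eq', Finset.mem_univ, if_true, Finset.mul_sum, mul_assoc]

theorem load_mul_migrationProb (T : V → ℕ) (α : ℝ) (a : Fin m → V) (v : V) :
    (load a v : ℝ) * migrationProb T α a v = α * nodePotential T a v := by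
  unfold migrationProb
  rcases Nat.eq_zero_or_pos (load a v) with h | h
  · simp [nodePotential, h]
  · have : (load a v : ℝ) ≠ 0 := by exact_mod_cast h.ne'
    field_simp

/-- The users on `v` share one migration probability `p`, and load times `p` is `α Φ_v`. Hence `1 +
x ≤ exp x`, raised to the load, gives a bound free of the load. -/
theorem prod_users_le (G : SimpleGraph V) [DecidableRel G.Adj] (T : V → ℕ) {α : ℝ}
    (h0 : 0 ≤ α) (h1 : α ≤ 1) (a : Fin m → V) (v : V) (f : V → ℝ) (hf : ∀ w, 0 ≤ f w)
    (hv : f v = 1) :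
    ∏ i with a i = v, ∑ w, userStep G T α a i w * f w
      ≤ Real.exp (α * nodePotential T a v * ((∑ w, walkMatrix G v w * f w) - 1)) := by
  have hp := migrationProb_nonneg T h0 a v
  have hp1 := (migrationProb_le T h0 a v).trans h1
  have hs : 0 ≤ ∑ w, walkMatrix G v w * f w :=
    Finset.sum_nonneg fun w _ => mul_nonneg (walkMatrix_nonneg G v w) (hf w)
  have : ∏ i with a i = v, ∑ w, userStep G T α a i w * f w
      = ((1 - migrationProb T α a v) + migrationProb T α a v * ∑ w, walkMatrix G v w * f w)
        ^ load a v := by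
    rw [load, ← Finset.prod_const]
    refine Finset.prod_congr rfl fun i hi => ?_
    rw [sum_userStep_mul, (Finset.mem_filter.1 hi).2, hv, mul_one]
  rw [this, ← load_mul_migrationProb, mul_assoc, Real.exp_nat_mul]
  refine pow_le_pow_left₀ ?_ ?_ _
  · have := mul_nonneg hp hs
    linarith
  · have := Real.add_one_le_exp (migrationProb T α a v * ((∑ w, walkMatrix G v w * f w) - 1))
    linarith

/-- The concave reparametrisation `h ↦ h - 2 h²` of exponents. -/
noncomputable def tilt (h : ℝ) : ℝ := h - 2 * h ^ 2

theorem lazyWalkMatrix_mulVec (G : SimpleGraph V) [DecidableRel G.Adj] (α : ℝ) (h : V → ℝ)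
    (v : V) :
    (lazyWalkMatrix G α).mulVec h v = (1 - α) * h v + α * ∑ w, walkMatrix G v w * h w := by
  rw [lazyWalkMatrix, Matrix.add_mulVec, Matrix.smul_mulVec, Matrix.smul_mulVec, Matrix.one_mulVec]
  rfl

/-- The concave `tilt` gains twice the variance of `h` under one lazy step, while the quadratic
error of the exponential is at most `α` times the mean of `(h w - h v)²` over neighbours `w`. For `α
≤ 1/2` the gain dominates. -/
theorem tilt_lazyWalk (G : SimpleGraph V) [DecidableRel G.Adj] {α : ℝ} (h0 : 0 ≤ α)
    (h1 : α ≤ 1 / 2) (h : V → ℝ) (hh : ∀ v, 0 ≤ h v ∧ h v ≤ 1 / 20) (v : V)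
    (hv : 0 < G.degree v) :
    tilt (h v) + α * ((∑ w, walkMatrix G v w * Real.exp (tilt (h w) - tilt (h v))) - 1)
      ≤ tilt ((lazyWalkMatrix G α).mulVec h v) := by
  set W := fun w => walkMatrix G v w
  have hW : ∑ w, W w = 1 := walkMatrix_row_sum G v hv
  have hW0 : ∀ w, 0 ≤ W w := walkMatrix_nonneg G v
  set A := ∑ w, W w * h w
  set B := ∑ w, W w * h w ^ 2
  have hP : (lazyWalkMatrix G α).mulVec h v = (1 - α) * h v + α * A :=
    lazyWalkMatrix_mulVec G α h v
  -- `exp x ≤ 1 + x + x²` for `|x| ≤ 1`, and `tilt` is 1-Lipschitz on `[0, 1/20]`.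
  have hexp : ∀ w, Real.exp (tilt (h w) - tilt (h v))
      ≤ 1 + (tilt (h w) - tilt (h v)) + (h w - h v) ^ 2 := by
    intro w
    have hfac : tilt (h w) - tilt (h v) = (h w - h v) * (1 - 2 * (h w + h v)) := by
      unfold tilt; ring
    obtain ⟨w0, w1⟩ := hh w
    obtain ⟨v0, v1⟩ := hh v
    have hsq : (tilt (h w) - tilt (h v)) ^ 2 ≤ (h w - h v) ^ 2 := by
      rw [hfac, mul_pow]
      have : (1 - 2 * (h w + h v)) ^ 2 ≤ 1 := by nlinarith
      nlinarith [sq_nonneg (h w - h v)]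
    have habs : |tilt (h w) - tilt (h v)| ≤ 1 := by
      refine (sq_le_one_iff_abs_le_one _).1 ?_
      have : |h w - h v| ≤ 1 := abs_le.2 ⟨by linarith, by linarith⟩
      have := (sq_le_one_iff_abs_le_one _).2 this
      linarith
    have := (abs_le.1 (Real.abs_exp_sub_one_sub_id_le habs)).2
    linarith
  have hsum : ∑ w, W w * Real.exp (tilt (h w) - tilt (h v))
      ≤ 1 + (A - 2 * B - tilt (h v)) + (B - 2 * h v * A + h v ^ 2) := by
    refine (Finset.sum_le_sum fun w _ => mul_le_mul_of_nonneg_left (hexp w) (hW0 w)).trans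
      (le_of_eq ?_)
    have : ∀ w, W w * (1 + (tilt (h w) - tilt (h v)) + (h w - h v) ^ 2)
        = W w * (1 - tilt (h v) + h v ^ 2) + (W w * h w) * (1 - 2 * h v)
          - W w * h w ^ 2 := by
      intro w; unfold tilt; ring
    simp only [this, Finset.sum_add_distrib, Finset.sum_sub_distrib, ← Finset.sum_mul, hW]
    simp only [A, B]
    ring
  have hvar : A ^ 2 ≤ B := by
    have : 0 ≤ ∑ w, W w * (h w - A) ^ 2 :=
      Finset.sum_nonneg fun w _ => mul_nonneg (hW0 w) (sq_nonneg _)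
    have e : ∀ w, W w * (h w - A) ^ 2 = W w * h w ^ 2 - (W w * h w) * (2 * A) + W w * A ^ 2 := by
      intro w; ring
    simp only [e, Finset.sum_add_distrib, Finset.sum_sub_distrib, ← Finset.sum_mul, hW] at this
    have : 0 ≤ B - A * (2 * A) + 1 * A ^ 2 := this
    nlinarith
  rw [hP]
  have := mul_le_mul_of_nonneg_left hsum h0
  refine le_trans (b := tilt (h v) + α * ((A - 2 * B - tilt (h v))
    + (B - 2 * h v * A + h v ^ 2))) (by linarith) ?_
  unfold tilt
  have h2 : 0 ≤ B - 2 * h v * A + h v ^ 2 := by nlinarith [sq_nonneg (A - h v)]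
  -- Gain minus error is exactly the sum of the expressions in `h3` and `h4`.
  have h3 : 0 ≤ α * (1 - 2 * α) * (B - 2 * h v * A + h v ^ 2) :=
    mul_nonneg (mul_nonneg h0 (by linarith)) h2
  have h4 : 0 ≤ 2 * α ^ 2 * (B - A ^ 2) := mul_nonneg (by positivity) (by linarith)
  nlinarith

theorem exp_one_add_le_three : Real.exp (1 + 1 / 20) ≤ 3 := by
  rw [Real.exp_add]
  have h1 := Real.exp_one_lt_d9
  have h2 := (abs_le.1 (Real.abs_exp_sub_one_sub_id_le (x := 1 / 20) (by
    rw [abs_of_nonneg] <;> norm_num))).2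
  have h3 : Real.exp (1 / 20) ≤ 1.0525 := by norm_num at h2 ⊢; linarith
  nlinarith [Real.exp_pos 1, Real.exp_pos (1 / 20)]

theorem tilt_nonneg {h : ℝ} (h0 : 0 ≤ h) (h1 : h ≤ 1 / 20) : 0 ≤ tilt h := by
  unfold tilt; nlinarith

theorem tilt_le (h : ℝ) : tilt h ≤ h := by
  unfold tilt; nlinarith [sq_nonneg h]

/-- Exponential moment of the potential after one round. -/
theorem sum_roundMatrix_mul_exp_le (G : SimpleGraph V) [DecidableRel G.Adj] (T : V → ℕ) {α : ℝ}
    (h0 : 0 ≤ α) (h1 : α ≤ 1 / 2) (hG : ∀ v, 0 < G.degree v) (a : Fin m → V)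
    (h : V → ℝ) (hh : ∀ v, 0 ≤ h v ∧ h v ≤ 1 / 20) :
    ∑ b, roundMatrix m G T α a b * Real.exp (∑ v, tilt (h v) * nodePotential T b v)
      ≤ Real.exp (∑ v, tilt ((lazyWalkMatrix G α).mulVec h v) * nodePotential T a v
          + ∑ v, h v) := by
  have hα1 : α ≤ 1 := by linarith
  set θ : V → ℝ := fun v => tilt (h v) with hθdef
  have hθ : ∀ v, 0 ≤ θ v := fun v => tilt_nonneg (hh v).1 (hh v).2
  have hθ1 : ∀ v, θ v ≤ 1 / 20 := fun v => (tilt_le _).trans (hh v).2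
  refine (Finset.sum_le_sum fun b _ => mul_le_mul_of_nonneg_left (exp_potential_le T a b θ hθ)
    (roundMatrix_nonneg G T h0 hα1 a b)).trans ?_
  unfold roundMatrix
  rw [sum_prod_mul_prod_add a (userStep G T α a) (fun v => Real.exp (θ v * nodePotential T a v))
    (fun v => θ v * Real.exp (-(nodePotential T a v : ℝ))) (moveWeight θ) (surplusWeight θ),
    ← Finset.sum_add_distrib, Real.exp_sum]
  have hu : ∀ i w, 0 ≤ userStep G T α a i w := by
    intro i w
    have hp := migrationProb_nonneg T h0 a (a i)
    have hq := (migrationProb_le T h0 a (a i)).trans hα1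
    have hw := walkMatrix_nonneg G (a i) w
    unfold userStep
    have h2 : 0 ≤ 1 - migrationProb T α a (a i) := by linarith
    split_ifs <;> positivity
  have hm : ∀ v w, 0 ≤ moveWeight θ v w := by
    intro v w; unfold moveWeight; split_ifs <;> positivity
  have hs : ∀ v w, 0 ≤ surplusWeight θ v w := by
    intro v w; unfold surplusWeight; split_ifs <;> positivity
  refine Finset.prod_le_prod (fun v _ => ?_) fun v _ => ?_
  · refine add_nonneg (mul_nonneg (Real.exp_pos _).le ?_)
      (mul_nonneg (mul_nonneg (hθ v) (Real.exp_pos _).le) ?_)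
    · exact Finset.prod_nonneg fun i _ => Finset.sum_nonneg fun w _ => mul_nonneg (hu i w) (hm v w)
    · exact Finset.prod_nonneg fun i _ => Finset.sum_nonneg fun w _ => mul_nonneg (hu i w) (hs v w)
  have hΦ : (0 : ℝ) ≤ nodePotential T a v := Nat.cast_nonneg _
  have hPnn : 0 ≤ tilt ((lazyWalkMatrix G α).mulVec h v) := by
    have hA0 : 0 ≤ ∑ w, walkMatrix G v w * h w :=
      Finset.sum_nonneg fun w _ => mul_nonneg (walkMatrix_nonneg G v w) (hh w).1
    have hA1 : ∑ w, walkMatrix G v w * h w ≤ 1 / 20 := by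
      refine (Finset.sum_le_sum fun w _ => mul_le_mul_of_nonneg_left (hh w).2
        (walkMatrix_nonneg G v w)).trans (le_of_eq ?_)
      rw [← Finset.sum_mul, walkMatrix_row_sum G v (hG v), one_mul]
    rw [lazyWalkMatrix_mulVec]
    have := hh v
    apply tilt_nonneg <;> nlinarith
  have b1 : Real.exp (θ v * nodePotential T a v) *
      ∏ i with a i = v, ∑ w, userStep G T α a i w * moveWeight θ v w
      ≤ Real.exp (tilt ((lazyWalkMatrix G α).mulVec h v) * nodePotential T a v) := by
    refine (mul_le_mul_of_nonneg_left (prod_users_le G T h0 hα1 a v (moveWeight θ v) (hm v)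
      (by simp [moveWeight])) (Real.exp_pos _).le).trans ?_
    rw [← Real.exp_add]
    refine Real.exp_le_exp.2 ?_
    have e : ∑ w, walkMatrix G v w * moveWeight θ v w
        = ∑ w, walkMatrix G v w * Real.exp (tilt (h w) - tilt (h v)) := by
      refine Finset.sum_congr rfl fun w _ => ?_
      by_cases hw : w = v
      · subst hw; simp [walkMatrix_self]
      · simp [moveWeight, hw, hθdef]
    rw [e]
    have := mul_le_mul_of_nonneg_right (tilt_lazyWalk G h0 h1 h hh v (hG v)) hΦ
    simp only [hθdef]
    linarith
  -- Surplus weights are at most 3, so the users contribute at most `exp (2 α Φ_v)`, which `exp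
  -- (-Φ_v)` cancels since `2α ≤ 1`.
  have b2 : θ v * Real.exp (-(nodePotential T a v : ℝ)) *
      ∏ i with a i = v, ∑ w, userStep G T α a i w * surplusWeight θ v w ≤ θ v := by
    refine (mul_le_mul_of_nonneg_left (prod_users_le G T h0 hα1 a v (surplusWeight θ v) (hs v)
      (by simp [surplusWeight])) (mul_nonneg (hθ v) (Real.exp_pos _).le)).trans ?_
    rw [mul_assoc, ← Real.exp_add]
    refine mul_le_of_le_one_right (hθ v) (Real.exp_le_one_iff.2 ?_)
    have e : ∑ w, walkMatrix G v w * surplusWeight θ v w ≤ 3 := by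
      have : ∑ w, walkMatrix G v w * surplusWeight θ v w ≤ ∑ w, walkMatrix G v w * 3 := by
        refine Finset.sum_le_sum fun w _ => mul_le_mul_of_nonneg_left ?_ (walkMatrix_nonneg G v w)
        unfold surplusWeight
        split_ifs
        · norm_num
        · exact (Real.exp_le_exp.2 (by linarith [hθ1 w])).trans exp_one_add_le_three
      rw [← Finset.sum_mul, walkMatrix_row_sum G v (hG v)] at this
      linarith
    have : α * nodePotential T a v * ((∑ w, walkMatrix G v w * surplusWeight θ v w) - 1)
        ≤ α * nodePotential T a v * 2 :=
      mul_le_mul_of_nonneg_left (by linarith) (mul_nonneg h0 hΦ)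
    nlinarith
  have b3 : θ v ≤ h v := tilt_le _
  have b4 := Real.add_one_le_exp (h v)
  -- Since the main term is at least 1, adding `θ v` costs at most the factor `1 + h v ≤ exp (h v)`.
  have b5 : 1 ≤ Real.exp (tilt ((lazyWalkMatrix G α).mulVec h v) * nodePotential T a v) :=
    Real.one_le_exp (mul_nonneg hPnn hΦ)
  rw [Real.exp_add]
  have := (hh v).1
  nlinarith

theorem lazyWalkMatrix_mulVec_mem (G : SimpleGraph V) [DecidableRel G.Adj] {α : ℝ}
    (h0 : 0 ≤ α) (h1 : α ≤ 1) (hG : ∀ v, 0 < G.degree v) {c : ℝ} (h : V → ℝ)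
    (hh : ∀ v, 0 ≤ h v ∧ h v ≤ c) (v : V) :
    0 ≤ (lazyWalkMatrix G α).mulVec h v ∧ (lazyWalkMatrix G α).mulVec h v ≤ c := by
  have hA0 : 0 ≤ ∑ w, walkMatrix G v w * h w :=
    Finset.sum_nonneg fun w _ => mul_nonneg (walkMatrix_nonneg G v w) (hh w).1
  have hA1 : ∑ w, walkMatrix G v w * h w ≤ c := by
    refine (Finset.sum_le_sum fun w _ => mul_le_mul_of_nonneg_left (hh w).2
      (walkMatrix_nonneg G v w)).trans (le_of_eq ?_)
    rw [← Finset.sum_mul, walkMatrix_row_sum G v (hG v), one_mul]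
  rw [lazyWalkMatrix_mulVec]
  have := hh v
  constructor <;> nlinarith

theorem roundMatrix_pow_nonneg (G : SimpleGraph V) [DecidableRel G.Adj] (T : V → ℕ) {α : ℝ}
    (h0 : 0 ≤ α) (h1 : α ≤ 1) (t : ℕ) (a b : Fin m → V) : 0 ≤ (roundMatrix m G T α ^ t) a b := by
  induction t generalizing b with
  | zero => rw [pow_zero, Matrix.one_apply]; split_ifs <;> norm_num
  | succ t ih =>
    rw [pow_succ, Matrix.mul_apply]
    exact Finset.sum_nonneg fun c _ => mul_nonneg (ih c) (roundMatrix_nonneg G T h0 h1 c b)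

theorem roundMatrix_pow_row_sum (G : SimpleGraph V) [DecidableRel G.Adj] (T : V → ℕ) (α : ℝ)
    (hG : ∀ v, 0 < G.degree v) (t : ℕ) (a : Fin m → V) :
    ∑ b, (roundMatrix m G T α ^ t) a b = 1 := by
  induction t with
  | zero => simp [Matrix.one_apply]
  | succ t ih =>
    simp only [pow_succ, Matrix.mul_apply]
    rw [Finset.sum_comm]
    simp only [← Finset.mul_sum, roundMatrix_row_sum G T α hG, mul_one, ih]

/-- Exponential moment of the potential after `t` rounds. -/
theorem sum_roundMatrix_pow_mul_exp_le (G : SimpleGraph V) [DecidableRel G.Adj] (T : V → ℕ)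
    {α : ℝ} (h0 : 0 ≤ α) (h1 : α ≤ 1 / 2) (hG : ∀ v, 0 < G.degree v) (a : Fin m → V) (t : ℕ)
    (h : V → ℝ) (hh : ∀ v, 0 ≤ h v ∧ h v ≤ 1 / 20) :
    ∑ b, (roundMatrix m G T α ^ t) a b * Real.exp (∑ v, tilt (h v) * nodePotential T b v)
      ≤ Real.exp (∑ v, tilt ((lazyWalkMatrix G α ^ t).mulVec h v) * nodePotential T a v
          + ∑ s ∈ Finset.range t, ∑ v, (lazyWalkMatrix G α ^ s).mulVec h v) := by
  induction t generalizing h with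
  | zero => simp [Matrix.one_apply]
  | succ t ih =>
    have hα1 : α ≤ 1 := by linarith
    -- The last round is averaged out first: exponents evolve backwards in time.
    have e : ∑ b, (roundMatrix m G T α ^ (t + 1)) a b *
          Real.exp (∑ v, tilt (h v) * nodePotential T b v)
        = ∑ c, (roundMatrix m G T α ^ t) a c *
          ∑ b, roundMatrix m G T α c b * Real.exp (∑ v, tilt (h v) * nodePotential T b v) := by
      simp only [pow_succ, Matrix.mul_apply, Finset.sum_mul, Finset.mul_sum, mul_assoc]
      rw [Finset.sum_comm]
    rw [e]
    refine (Finset.sum_le_sum fun c _ => mul_le_mul_of_nonneg_left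
      (sum_roundMatrix_mul_exp_le G T h0 h1 hG c h hh)
      (roundMatrix_pow_nonneg G T h0 hα1 t a c)).trans ?_
    have := ih ((lazyWalkMatrix G α).mulVec h) (lazyWalkMatrix_mulVec_mem G h0 hα1 hG h hh)
    simp only [Real.exp_add _ (∑ v, h v), ← mul_assoc, ← Finset.sum_mul]
    refine (mul_le_mul_of_nonneg_right this (Real.exp_pos _).le).trans (le_of_eq ?_)
    rw [← Real.exp_add, Finset.sum_range_succ']
    simp only [Matrix.mulVec_mulVec, ← pow_succ, pow_zero, Matrix.one_mulVec, add_assoc]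

end Round

/-! ### Spectral convergence of the lazy walk -/

section Mixing

variable {V : Type*} [Fintype V] [DecidableEq V]

theorem abs_pow_apply_le_of_eigenvalues {X : Matrix V V ℝ} (hX : X.IsHermitian) {ρ : ℝ}
    (h : ∀ k, |hX.eigenvalues k| ≤ ρ) (t : ℕ) (u v : V) : |(X ^ t) u v| ≤ ρ ^ t := by
  set U : Matrix V V ℝ := (hX.eigenvectorUnitary : Matrix V V ℝ) with hU
  have hUU : U * star U = 1 := Unitary.coe_mul_star_self hX.eigenvectorUnitary
  have hrow : ∀ u, ∑ k, U u k ^ 2 = 1 := by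
    intro u
    have := congrFun (congrFun hUU u) u
    rw [Matrix.mul_apply, Matrix.one_apply_eq] at this
    rw [← this]
    refine Finset.sum_congr rfl fun k _ => ?_
    rw [Matrix.star_apply, star_trivial, sq]
  have hpow : (X ^ t) u v = ∑ k, U u k * hX.eigenvalues k ^ t * U v k := by
    conv_lhs => rw [hX.spectral_theorem]
    rw [← map_pow, Matrix.diagonal_pow, Unitary.conjStarAlgAut_apply, Matrix.mul_apply]
    refine Finset.sum_congr rfl fun k _ => ?_
    rw [Matrix.mul_diagonal]
    simp [hU]
  rw [hpow]
  have hρ : 0 ≤ ρ := (abs_nonneg _).trans (h u)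
  calc |∑ k, U u k * hX.eigenvalues k ^ t * U v k|
      ≤ ∑ k, |U u k * hX.eigenvalues k ^ t * U v k| := Finset.abs_sum_le_sum_abs _ _
    _ ≤ ∑ k, ρ ^ t * ((U u k ^ 2 + U v k ^ 2) / 2) := by
        refine Finset.sum_le_sum fun k _ => ?_
        rw [abs_mul, abs_mul, abs_pow]
        have h1 : |hX.eigenvalues k| ^ t ≤ ρ ^ t := pow_le_pow_left₀ (abs_nonneg _) (h k) t
        have h2 : |U u k| * |U v k| ≤ (U u k ^ 2 + U v k ^ 2) / 2 := by
          nlinarith [sq_nonneg (|U u k| - |U v k|), sq_abs (U u k), sq_abs (U v k)]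
        calc |U u k| * |hX.eigenvalues k| ^ t * |U v k|
            = |hX.eigenvalues k| ^ t * (|U u k| * |U v k|) := by ring
          _ ≤ _ := mul_le_mul h1 h2 (by positivity) (by positivity)
    _ = ρ ^ t := by
        rw [← Finset.mul_sum, ← Finset.sum_div, Finset.sum_add_distrib, hrow, hrow]; norm_num

/-- The second largest absolute value of an eigenvalue, as it enters `eigenGap`. -/
noncomputable def secondEigenvalue (M : Matrix V V ℝ) : ℝ :=
  sSup {r : ℝ | ∃ l : ℝ, Module.End.HasEigenvalue (Matrix.toLin' M) l ∧ |l| < 1 ∧ r = |l|}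

theorem secondEigenvalue_set_finite (M : Matrix V V ℝ) :
    {r : ℝ | ∃ l : ℝ, Module.End.HasEigenvalue (Matrix.toLin' M) l ∧ |l| < 1 ∧ r = |l|}.Finite := by
  refine ((Module.End.finite_hasEigenvalue (Matrix.toLin' M)).image fun l => |l|).subset ?_
  rintro r ⟨l, hl, -, rfl⟩
  exact ⟨l, hl, rfl⟩

theorem secondEigenvalue_nonneg (M : Matrix V V ℝ) : 0 ≤ secondEigenvalue M := by
  refine Real.sSup_nonneg ?_
  rintro r ⟨l, -, -, rfl⟩
  exact abs_nonneg l

/-- There are finitely many eigenvalues, so the supremum is attained or the set is empty, where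
`sSup` is 0. -/
theorem secondEigenvalue_lt_one (M : Matrix V V ℝ) : secondEigenvalue M < 1 := by
  rcases Set.eq_empty_or_nonempty
    {r : ℝ | ∃ l : ℝ, Module.End.HasEigenvalue (Matrix.toLin' M) l ∧ |l| < 1 ∧ r = |l|} with h | h
  · rw [secondEigenvalue, h, Real.sSup_empty]; exact one_pos
  · obtain ⟨l, -, hl, e⟩ := h.csSup_mem (secondEigenvalue_set_finite M)
    rw [secondEigenvalue, e]; exact hl

theorem abs_le_secondEigenvalue {M : Matrix V V ℝ} {l : ℝ}
    (hl : Module.End.HasEigenvalue (Matrix.toLin' M) l) (h1 : |l| < 1) :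
    |l| ≤ secondEigenvalue M :=
  le_csSup (secondEigenvalue_set_finite M).bddAbove ⟨l, hl, h1, rfl⟩

theorem eigenGap_eq (M : Matrix V V ℝ) : eigenGap M = 1 - secondEigenvalue M := rfl

variable (G : SimpleGraph V) [DecidableRel G.Adj]

theorem degree_mul_walkMatrix (hG : ∀ v, 0 < G.degree v) (u v : V) :
    (G.degree u : ℝ) * walkMatrix G u v = if G.Adj u v then 1 else 0 := by
  have : (G.degree u : ℝ) ≠ 0 := by exact_mod_cast (hG u).ne'
  unfold walkMatrix
  split_ifs
  · field_simp
  · simp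

theorem sum_degree_eq : ∑ v, (G.degree v : ℝ) = 2 * (G.edgeFinset.card : ℝ) := by
  exact_mod_cast G.sum_degrees_eq_twice_card_edges

theorem sum_sum_adj_mul_sq_left (y : V → ℝ) :
    ∑ u, ∑ v, (if G.Adj u v then (1 : ℝ) else 0) * y u ^ 2 = ∑ u, (G.degree u : ℝ) * y u ^ 2 := by
  refine Finset.sum_congr rfl fun u _ => ?_
  rw [← Finset.sum_mul, ← Finset.sum_filter, Finset.sum_const, nsmul_eq_mul, mul_one,
    ← SimpleGraph.card_neighborFinset_eq_degree, SimpleGraph.neighborFinset_eq_filter]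

theorem sum_sum_adj_mul_sq_right (y : V → ℝ) :
    ∑ u, ∑ v, (if G.Adj u v then (1 : ℝ) else 0) * y v ^ 2 = ∑ u, (G.degree u : ℝ) * y u ^ 2 := by
  rw [Finset.sum_comm, ← sum_sum_adj_mul_sq_left]
  simp only [G.adj_comm]

/-- Eigenvalues with an eigenvector orthogonal to the stationary distribution lie strictly
inside the unit interval. -/
theorem abs_eigenvalue_lt_one {α : ℝ} (h0 : 0 < α) (h1 : α ≤ 1 / 2) (hG : ∀ v, 0 < G.degree v)
    (hconn : G.Connected) {y : V → ℝ} (hy : y ≠ 0) {η : ℝ}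
    (he : (lazyWalkMatrix G α).mulVec y = η • y) (horth : ∑ u, (G.degree u : ℝ) * y u = 0) :
    |η| < 1 := by
  set A : V → V → ℝ := fun u v => if G.Adj u v then 1 else 0
  set N := ∑ u, (G.degree u : ℝ) * y u ^ 2
  set C := ∑ u, ∑ v, A u v * (y u * y v)
  have hd : ∀ u, (0 : ℝ) < G.degree u := fun u => by exact_mod_cast hG u
  have hN : 0 < N := by
    obtain ⟨u, hu⟩ := Function.ne_iff.1 hy
    refine Finset.sum_pos' (fun u _ => mul_nonneg (hd u).le (sq_nonneg _))
      ⟨u, Finset.mem_univ u, mul_pos (hd u) (sq_pos_of_ne_zero hu)⟩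
  -- Pairing the eigenvalue equation with `deg · y` expresses `η` through the Rayleigh quotient `C /
  -- N`; the squares of `y u ± y v` give `|C| ≤ N`.
  have hη : η * N = (1 - α) * N + α * C := by
    simp only [N, C, Finset.mul_sum]
    rw [← Finset.sum_add_distrib]
    refine Finset.sum_congr rfl fun u _ => ?_
    have := congrFun he u
    rw [lazyWalkMatrix_mulVec, Pi.smul_apply, smul_eq_mul] at this
    have e : ∀ v, α * (A u v * (y u * y v))
        = (G.degree u : ℝ) * y u * (α * (walkMatrix G u v * y v)) := by
      intro v
      simp only [A]
      rw [← degree_mul_walkMatrix G hG]; ring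
    simp only [e, ← Finset.mul_sum]
    linear_combination -(G.degree u : ℝ) * y u * this
  have hsq : ∀ c : ℝ, ∑ u, ∑ v, A u v * (y u + c * y v) ^ 2 = N + 2 * c * C + c ^ 2 * N := by
    intro c
    have e : ∀ u v, A u v * (y u + c * y v) ^ 2
        = A u v * y u ^ 2 + 2 * c * (A u v * (y u * y v)) + c ^ 2 * (A u v * y v ^ 2) := by
      intro u v; ring
    simp only [e, Finset.sum_add_distrib, ← Finset.mul_sum]
    rw [sum_sum_adj_mul_sq_left, sum_sum_adj_mul_sq_right]
  have hA : ∀ u v, 0 ≤ A u v := by intro u v; simp only [A]; split_ifs <;> norm_num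
  have hpos : ∀ c : ℝ, 0 ≤ ∑ u, ∑ v, A u v * (y u + c * y v) ^ 2 := fun c =>
    Finset.sum_nonneg fun u _ => Finset.sum_nonneg fun v _ => mul_nonneg (hA u v) (sq_nonneg _)
  have hp := hpos 1
  have hm := hpos (-1)
  rw [hsq] at hp hm
  -- Equality would make `y` constant along edges, hence constant by connectedness, contradicting
  -- orthogonality to the degrees.
  have hstrict : C < N := by
    rcases lt_or_eq_of_le (show C ≤ N by linarith) with h | h
    · exact h
    exfalso
    have hz : ∑ u, ∑ v, A u v * (y u + (-1) * y v) ^ 2 = 0 := by rw [hsq]; linarith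
    have hadj : ∀ u v, G.Adj u v → y u = y v := by
      intro u v huv
      have hu := (Finset.sum_eq_zero_iff_of_nonneg fun u _ => Finset.sum_nonneg fun v _ =>
        mul_nonneg (hA u v) (sq_nonneg _)).1 hz u (Finset.mem_univ u)
      have hv := (Finset.sum_eq_zero_iff_of_nonneg fun v _ =>
        mul_nonneg (hA u v) (sq_nonneg _)).1 hu v (Finset.mem_univ v)
      simp only [A, huv, if_true, one_mul] at hv
      have := pow_eq_zero_iff (two_ne_zero) |>.1 hv
      linarith
    have hwalk : ∀ u v, y u = y v := by
      intro u v
      obtain ⟨p⟩ := hconn.preconnected u v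
      induction p with
      | nil => rfl
      | cons h _ ih => exact (hadj _ _ h).trans ih
    obtain ⟨u, hu⟩ := Function.ne_iff.1 hy
    have : (∑ v, (G.degree v : ℝ)) * y u = 0 := by
      rw [Finset.sum_mul, ← horth]
      exact Finset.sum_congr rfl fun v _ => by rw [hwalk u v]
    rcases mul_eq_zero.1 this with h | h
    · exact (Finset.sum_pos (fun v _ => hd v) ⟨u, Finset.mem_univ u⟩).ne' h
    · exact hu h
  rw [abs_lt]
  constructor
  -- Laziness gives `η ≥ 1 - 2α ≥ 0`.
  · by_contra! h
    nlinarith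
  · by_contra! h
    nlinarith

theorem lazyWalkMatrix_mulVec_one (α : ℝ) (hG : ∀ v, 0 < G.degree v) :
    (lazyWalkMatrix G α).mulVec (fun _ => 1) = fun _ => 1 := by
  funext v
  rw [lazyWalkMatrix_mulVec]
  simp only [mul_one]
  rw [walkMatrix_row_sum G v (hG v)]
  ring

theorem degree_mul_lazyWalkMatrix_symm (α : ℝ) (hG : ∀ v, 0 < G.degree v) (u v : V) :
    (G.degree u : ℝ) * lazyWalkMatrix G α u v = (G.degree v : ℝ) * lazyWalkMatrix G α v u := by
  have h := degree_mul_walkMatrix G hG u v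
  have h' := degree_mul_walkMatrix G hG v u
  simp only [G.adj_comm v u, ← h] at h'
  simp only [lazyWalkMatrix, Matrix.add_apply, Matrix.smul_apply, smul_eq_mul]
  by_cases huv : u = v
  · subst huv; rfl
  · rw [Matrix.one_apply_ne huv, Matrix.one_apply_ne (Ne.symm huv)]
    linear_combination -α * h'

/-- Convergence of the lazy random walk to its stationary distribution. -/
theorem lazyWalkMatrix_pow_le {α : ℝ} (h0 : 0 < α) (h1 : α ≤ 1 / 2) (hG : ∀ v, 0 < G.degree v)
    (hconn : G.Connected) {t : ℕ} (ht : t ≠ 0) (u v : V) :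
    (lazyWalkMatrix G α ^ t) u v ≤ stationary G v
      + secondEigenvalue (lazyWalkMatrix G α) ^ t * Real.sqrt (G.degree v) := by
  set P := lazyWalkMatrix G α with hP
  set s : V → ℝ := fun v => Real.sqrt (G.degree v) with hs
  have hd : ∀ u, (0 : ℝ) < G.degree u := fun u => by exact_mod_cast hG u
  have hs0 : ∀ v, 0 < s v := fun v => Real.sqrt_pos.2 (hd v)
  have hss : ∀ v, s v * s v = G.degree v := fun v => Real.mul_self_sqrt (hd v).le
  set E : ℝ := 2 * (G.edgeFinset.card : ℝ) with hE
  have hEsum : ∑ v, (G.degree v : ℝ) = E := sum_degree_eq G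
  have hE0 : 0 < E := by
    rw [← hEsum]; exact Finset.sum_pos (fun v _ => hd v) ⟨u, Finset.mem_univ u⟩
  set D : Matrix V V ℝ := Matrix.diagonal s
  set Di : Matrix V V ℝ := Matrix.diagonal fun v => (s v)⁻¹
  have hDiD : Di * D = 1 := by
    rw [Matrix.diagonal_mul_diagonal, ← Matrix.diagonal_one]
    congr 1; funext v; exact inv_mul_cancel₀ (hs0 v).ne'
  have hDDi : D * Di = 1 := by
    rw [Matrix.diagonal_mul_diagonal, ← Matrix.diagonal_one]
    congr 1; funext v; exact mul_inv_cancel₀ (hs0 v).ne'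
  set S : Matrix V V ℝ := D * P * Di with hS
  have hSapp : ∀ u v, S u v = s u * P u v * (s v)⁻¹ := by
    intro u v; rw [hS, Matrix.mul_diagonal, Matrix.diagonal_mul]
  have hSsymm : ∀ u v, S u v = S v u := by
    intro u v
    rw [hSapp, hSapp]
    have := degree_mul_lazyWalkMatrix_symm G α hG u v
    rw [← hss, ← hss, ← hP] at this
    have a := (hs0 u).ne'
    have b := (hs0 v).ne'
    field_simp
    linear_combination this
  -- The orthogonal projection onto the top eigenvector `s` of the symmetrised walk `S`; undoing the
  -- symmetrisation turns it into `π`.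
  set J : Matrix V V ℝ := fun u v => s u * s v / E with hJ
  have hSJ : S * J = J := by
    ext u v
    rw [Matrix.mul_apply]
    have e : ∀ w, S u w * J w v = s u * s v / E * (P u w * 1) := by
      intro w
      rw [hSapp]
      have := (hs0 w).ne'
      simp only [hJ]; field_simp
    simp only [e, ← Finset.mul_sum]
    have := congrFun (lazyWalkMatrix_mulVec_one G α hG) u
    rw [Matrix.mulVec, dotProduct] at this
    rw [hP, this, mul_one]
  have hJsymm : ∀ u v, J u v = J v u := by
    intro u v; simp only [hJ]; ring
  have hJS : J * S = J := by
    ext u v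
    rw [Matrix.mul_apply]
    have := congrFun (congrFun hSJ v) u
    rw [Matrix.mul_apply] at this
    rw [hJsymm u v, ← this]
    exact Finset.sum_congr rfl fun w _ => by rw [hJsymm u w, hSsymm w v, mul_comm]
  have hJJ : J * J = J := by
    ext u v
    rw [Matrix.mul_apply]
    have e : ∀ w, J u w * J w v = s u * s v / E ^ 2 * (G.degree w : ℝ) := by
      intro w; simp only [hJ]; rw [← hss]; field_simp
    simp only [e, ← Finset.mul_sum, hEsum]
    simp only [hJ]; field_simp
  have hpowD : ∀ t, S ^ t = D * P ^ t * Di := by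
    intro t
    induction t with
    | zero => rw [pow_zero, pow_zero, mul_one, hDDi]
    | succ t ih =>
      rw [pow_succ, ih, hS, pow_succ]
      calc D * P ^ t * Di * (D * P * Di) = D * P ^ t * (Di * D) * P * Di := by noncomm_ring
        _ = _ := by rw [hDiD]; noncomm_ring
  have hSpowJ : ∀ t, S ^ t * J = J := by
    intro t
    induction t with
    | zero => rw [pow_zero, one_mul]
    | succ t ih => rw [pow_succ, mul_assoc, hSJ, ih]
  -- The exponent must be positive: at 0 the left side is 1, not `1 - J`.
  have hpow : ∀ t, (S - J) ^ (t + 1) = S ^ (t + 1) - J := by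
    intro t
    induction t with
    | zero => simp
    | succ t ih =>
      rw [pow_succ, ih, sub_mul, mul_sub, mul_sub, hSpowJ, hJS, hJJ, ← pow_succ]
      abel
  have hX : (S - J).IsHermitian := by
    ext u v
    rw [Matrix.conjTranspose_apply, star_trivial, Matrix.sub_apply, Matrix.sub_apply, hSsymm,
      hJsymm]
  have heig : ∀ k, |hX.eigenvalues k| ≤ secondEigenvalue P := by
    intro k
    set η := hX.eigenvalues k
    set x : V → ℝ := ⇑(hX.eigenvectorBasis k)
    have hx : (S - J).mulVec x = η • x := hX.mulVec_eigenvectorBasis k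
    have hx0 : x ≠ 0 := by
      intro h
      refine hX.eigenvectorBasis.orthonormal.ne_zero k ?_
      ext i
      exact congrFun h i
    -- For `η ≠ 0`, applying `J` shows that `x` is orthogonal to `s`; rescaled, it is an eigenvector
    -- of `P` orthogonal to the degrees.
    rcases eq_or_ne η 0 with h | hη
    · rw [h, abs_zero]; exact secondEigenvalue_nonneg P
    have hJx : J.mulVec x = 0 := by
      have := congrArg J.mulVec hx
      rw [Matrix.mulVec_mulVec, mul_sub, hJS, hJJ, sub_self, Matrix.zero_mulVec,
        Matrix.mulVec_smul] at this
      exact (smul_eq_zero.1 this.symm).resolve_left hη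
    have hSx : S.mulVec x = η • x := by rwa [Matrix.sub_mulVec, hJx, sub_zero] at hx
    set y := Di.mulVec x with hy
    have hyx : D.mulVec y = x := by rw [hy, Matrix.mulVec_mulVec, hDDi, Matrix.one_mulVec]
    have hy0 : y ≠ 0 := by
      intro h; rw [h, Matrix.mulVec_zero] at hyx; exact hx0 hyx.symm
    have hPy : P.mulVec y = η • y := by
      have := congrArg Di.mulVec hSx
      rw [Matrix.mulVec_smul, Matrix.mulVec_mulVec, hS, ← mul_assoc, ← mul_assoc, hDiD, one_mul,
        ← Matrix.mulVec_mulVec] at this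
      exact this
    have horth : ∑ u, (G.degree u : ℝ) * y u = 0 := by
      have := congrFun hJx u
      rw [Matrix.mulVec, dotProduct, Pi.zero_apply] at this
      have e : ∀ w, J u w * x w = s u / E * ((G.degree w : ℝ) * y w) := by
        intro w
        rw [← hyx, Matrix.mulVec_diagonal, ← hss]
        simp only [hJ]; ring
      simp only [e, ← Finset.mul_sum] at this
      exact (mul_eq_zero.1 this).resolve_left (div_pos (hs0 u) hE0).ne'
    refine abs_le_secondEigenvalue ?_ (abs_eigenvalue_lt_one G h0 h1 hG hconn hy0 hPy horth)
    refine Module.End.hasEigenvalue_of_hasEigenvector (x := y) ?_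
    rw [Module.End.hasEigenvector_iff]
    exact ⟨Module.End.mem_eigenspace_iff.2 (by rw [Matrix.toLin'_apply, hPy]), hy0⟩
  obtain ⟨r, rfl⟩ := Nat.exists_eq_succ_of_ne_zero ht
  have hb := (le_abs_self _).trans (abs_pow_apply_le_of_eigenvalues hX heig (r + 1) u v)
  rw [hpow, hpowD, Matrix.sub_apply, Matrix.mul_diagonal, Matrix.diagonal_mul] at hb
  have hs1 : 1 ≤ s u := Real.one_le_sqrt.2 (by exact_mod_cast hG u)
  have hρ : 0 ≤ secondEigenvalue P ^ (r + 1) := pow_nonneg (secondEigenvalue_nonneg P) _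
  have e : (P ^ (r + 1)) u v = stationary G v
      + (s u * (P ^ (r + 1)) u v * (s v)⁻¹ - J u v) * (s v / s u) := by
    have a := (hs0 u).ne'
    have b := (hs0 v).ne'
    simp only [hJ, stationary, ← hE]
    rw [← hss v]
    field_simp
    ring
  rw [Nat.succ_eq_add_one, e]
  refine add_le_add_right ?_ _
  have h2 : s v / s u ≤ s v := div_le_self (hs0 v).le hs1
  calc _ ≤ secondEigenvalue P ^ (r + 1) * (s v / s u) :=
        mul_le_mul_of_nonneg_right hb (div_pos (hs0 v) (hs0 u)).le
    _ ≤ _ := mul_le_mul_of_nonneg_left h2 hρ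

theorem mixingTime_ge (α : ℝ) [Nonempty V] :
    4 * Real.log (Fintype.card V) ≤ mixingTime G α := by
  unfold mixingTime
  rw [eigenGap_eq]
  have h1 := secondEigenvalue_lt_one (lazyWalkMatrix G α)
  have h2 := secondEigenvalue_nonneg (lazyWalkMatrix G α)
  rw [le_div_iff₀ (by linarith)]
  have : 0 ≤ Real.log (Fintype.card V) := Real.log_natCast_nonneg _
  nlinarith

theorem lazyWalkMatrix_pow_mixingTime_le {α : ℝ} (h0 : 0 < α) (h1 : α ≤ 1 / 2)
    (hG : ∀ v, 0 < G.degree v) (hconn : G.Connected) (hcard : 2 ≤ Fintype.card V) (u v : V) :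
    (lazyWalkMatrix G α ^ ⌈mixingTime G α⌉₊) u v
      ≤ stationary G v + 1 / (Fintype.card V : ℝ) ^ 3 := by
  have : Nonempty V := ⟨u⟩
  set n : ℝ := (Fintype.card V : ℝ) with hn
  have hn2 : (2 : ℝ) ≤ n := by rw [hn]; exact_mod_cast hcard
  have hlog : 0 < Real.log n := Real.log_pos (by linarith)
  have hX := mixingTime_ge G α
  set t := ⌈mixingTime G α⌉₊ with ht
  have htX : mixingTime G α ≤ t := Nat.le_ceil _
  have ht0 : t ≠ 0 := by
    have : (0 : ℝ) < t := by linarith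
    exact_mod_cast this.ne'
  refine (lazyWalkMatrix_pow_le G h0 h1 hG hconn ht0 u v).trans (add_le_add_right ?_ _)
  set ρ := secondEigenvalue (lazyWalkMatrix G α) with hρ
  have hρ0 : 0 ≤ ρ := secondEigenvalue_nonneg _
  have hρ1 : ρ < 1 := secondEigenvalue_lt_one _
  -- The factor 4 in the mixing time gives `n⁻⁴`; one power of `n` is then lost to the square root
  -- of the degree.
  have hpow : ρ ^ t ≤ 1 / n ^ 4 := by
    have a : ρ ≤ Real.exp (-(1 - ρ)) := by
      have := Real.add_one_le_exp (-(1 - ρ)); linarith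
    have b : 4 * Real.log n ≤ t * (1 - ρ) := by
      rw [← div_le_iff₀ (by linarith)]
      exact htX
    calc ρ ^ t ≤ Real.exp (-(1 - ρ)) ^ t := pow_le_pow_left₀ hρ0 a t
      _ = Real.exp (t * -(1 - ρ)) := (Real.exp_nat_mul _ _).symm
      _ ≤ Real.exp (-(4 * Real.log n)) := Real.exp_le_exp.2 (by linarith)
      _ = 1 / n ^ 4 := by
          rw [Real.exp_neg, show (4 : ℝ) * Real.log n = ((4 : ℕ) : ℝ) * Real.log n by norm_num,
            Real.exp_nat_mul, Real.exp_log (by linarith), one_div]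
  have hdeg : Real.sqrt (G.degree v) ≤ n := by
    have : (G.degree v : ℝ) ≤ n := by
      rw [hn]; exact_mod_cast (G.degree_lt_card_verts v).le
    refine (Real.sqrt_le_sqrt this).trans ?_
    exact Real.sqrt_le_iff.2 ⟨by linarith, by nlinarith⟩
  calc ρ ^ t * Real.sqrt (G.degree v) ≤ 1 / n ^ 4 * n :=
        mul_le_mul hpow hdeg (Real.sqrt_nonneg _) (by positivity)
    _ = 1 / n ^ 3 := by field_simp

end Mixing

/-! ### Tail bounds and the union bound -/

section Tail

variable {V : Type*} [Fintype V] [DecidableEq V] {m : ℕ}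

/-- Exponential tail bound for the potential of one node after `t` rounds. -/
theorem sum_roundMatrix_pow_tail_le (G : SimpleGraph V) [DecidableRel G.Adj] (T : V → ℕ)
    {α : ℝ} (h0 : 0 ≤ α) (h1 : α ≤ 1 / 2) (hG : ∀ v, 0 < G.degree v) (a : Fin m → V) (t : ℕ)
    (v : V) {c M τ K : ℝ} (hc0 : 0 ≤ c) (hc1 : c ≤ 1 / 20)
    (hM : ∑ u, (lazyWalkMatrix G α ^ t) u v * nodePotential T a u ≤ M)
    (hτ : ∑ s ∈ Finset.range t, ∑ u, (lazyWalkMatrix G α ^ s) u v ≤ τ) :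
    ∑ b with ¬ (nodePotential T b v : ℝ) ≤ K, (roundMatrix m G T α ^ t) a b
      ≤ Real.exp (c * M + c * τ - tilt c * K) := by
  have hα1 : α ≤ 1 := by linarith
  have hQ := roundMatrix_pow_nonneg G T h0 hα1 t a
  have hcn := tilt_nonneg hc0 hc1
  set h : V → ℝ := Pi.single v c
  have hh : ∀ u, 0 ≤ h u ∧ h u ≤ 1 / 20 := by
    intro u
    by_cases hu : u = v
    · subst hu; simpa [h] using And.intro hc0 hc1
    · simp [h, hu]
  have hmul : ∀ s u, (lazyWalkMatrix G α ^ s).mulVec h u = c * (lazyWalkMatrix G α ^ s) u v := by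
    intro s u
    simp [h, Matrix.mulVec_single, mul_comm]
  have hsum : ∀ b : Fin m → V, ∑ u, tilt (h u) * nodePotential T b u
      = tilt c * nodePotential T b v := by
    intro b
    rw [Finset.sum_eq_single v]
    · simp [h]
    · intro u _ hu; simp [h, hu, tilt]
    · simp
  have key := sum_roundMatrix_pow_mul_exp_le G T h0 h1 hG a t h hh
  simp only [hsum, hmul] at key
  have hexp : ∑ u, tilt (c * (lazyWalkMatrix G α ^ t) u v) * nodePotential T a u
      + ∑ s ∈ Finset.range t, ∑ u, c * (lazyWalkMatrix G α ^ s) u v ≤ c * M + c * τ := by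
    simp only [← Finset.mul_sum]
    refine add_le_add ?_ (mul_le_mul_of_nonneg_left hτ hc0)
    refine le_trans ?_ (mul_le_mul_of_nonneg_left hM hc0)
    rw [Finset.mul_sum]
    refine Finset.sum_le_sum fun u _ => ?_
    rw [← mul_assoc]
    exact mul_le_mul_of_nonneg_right (tilt_le _) (Nat.cast_nonneg _)
  have key2 := key.trans (Real.exp_le_exp.2 hexp)
  rw [Real.exp_sub, le_div_iff₀ (Real.exp_pos _)]
  refine le_trans ?_ key2
  rw [Finset.sum_mul]
  refine (Finset.sum_le_sum fun b hb => ?_).trans (Finset.sum_le_sum_of_subset_of_nonneg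
    (Finset.filter_subset _ _) fun b _ _ => mul_nonneg (hQ b) (Real.exp_pos _).le)
  have hb := (Finset.mem_filter.1 hb).2
  exact mul_le_mul_of_nonneg_left (Real.exp_le_exp.2
    (mul_le_mul_of_nonneg_left (not_le.1 hb).le hcn)) (hQ b)

/-- Choice of the exponent in the tail bound. -/
theorem exists_exponent {l M dev R τ : ℝ} (hl : 0 < l) (hM : 0 ≤ M)
    (hdev1 : 8 * Real.sqrt (2 * M * l) ≤ dev) (hdev0 : 0 ≤ dev) (hτ : 0 ≤ τ)
    (hR : τ + 200 * l ≤ 9 / 10 * R) :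
    ∃ c, 0 ≤ c ∧ c ≤ 1 / 20 ∧ c * M + c * τ - tilt c * (M + dev + R) ≤ -(2 * l) := by
  have hR0 : 0 ≤ R := by linarith
  have red : ∀ c, 0 ≤ c → c ≤ 1 / 20 →
      c * M + c * τ - tilt c * (M + dev + R)
        ≤ 2 * c ^ 2 * M - 9 / 10 * (c * dev) - c * (9 / 10 * R - τ) := by
    intro c c0 c1
    unfold tilt
    -- For `c ≤ 1/20`, the loss `2c²` in `tilt c` costs only a tenth of the gain from `dev + R`.
    have h1 : c * (c * (dev + R)) ≤ 1 / 20 * (c * (dev + R)) :=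
      mul_le_mul_of_nonneg_right c1 (mul_nonneg c0 (by linarith))
    nlinarith
  -- The choice `c = √(2l/M)` makes `2c²M = 4l`, and it is at most `1/20` exactly when `M ≥ 800 l`.
  -- For smaller `M` the cap `c = 1/20` is used, and the `200 l` in `hR` pays.
  rcases le_total M (800 * l) with h | h
  · refine ⟨1 / 20, by norm_num, le_rfl, (red _ (by norm_num) le_rfl).trans ?_⟩
    nlinarith
  · have hMpos : 0 < M := by linarith
    set c := Real.sqrt (2 * l / M)
    have c0 : 0 ≤ c := Real.sqrt_nonneg _
    have hc2 : c ^ 2 * M = 2 * l := by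
      rw [Real.sq_sqrt (by positivity)]; field_simp
    have c1 : c ≤ 1 / 20 := by
      refine Real.sqrt_le_iff.2 ⟨by norm_num, ?_⟩
      rw [div_le_iff₀ hMpos]; linarith
    refine ⟨c, c0, c1, (red _ c0 c1).trans ?_⟩
    have hcs : c * Real.sqrt (2 * M * l) = 2 * l := by
      rw [← Real.sqrt_mul (by positivity), Real.sqrt_eq_iff_mul_self_eq (by positivity)
        (by positivity)]
      field_simp
    have h2 : 16 * l ≤ c * dev := by
      have := mul_le_mul_of_nonneg_left hdev1 c0
      linarith
    have h3 : 0 ≤ c * (9 / 10 * R - τ) := mul_nonneg c0 (by linarith)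
    linarith

theorem lazyWalkMatrix_pow_entry_mem (G : SimpleGraph V) [DecidableRel G.Adj] {α : ℝ}
    (h0 : 0 ≤ α) (h1 : α ≤ 1) (hG : ∀ v, 0 < G.degree v) (s : ℕ) (u v : V) :
    0 ≤ (lazyWalkMatrix G α ^ s) u v ∧ (lazyWalkMatrix G α ^ s) u v ≤ 1 := by
  induction s generalizing u with
  | zero => rw [pow_zero, Matrix.one_apply]; split_ifs <;> norm_num
  | succ s ih =>
    rw [pow_succ', Matrix.mul_apply]
    exact lazyWalkMatrix_mulVec_mem G h0 h1 hG (fun w => (lazyWalkMatrix G α ^ s) w v) ih u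

theorem lazyWalkMatrix_pow_col_sum (G : SimpleGraph V) [DecidableRel G.Adj] (α : ℝ) {d : ℕ}
    (hd : G.IsRegularOfDegree d) (hG : ∀ v, 0 < G.degree v) (s : ℕ) (v : V) :
    ∑ u, (lazyWalkMatrix G α ^ s) u v = 1 := by
  have hsymm : ∀ u w, lazyWalkMatrix G α u w = lazyWalkMatrix G α w u := by
    intro u w
    have := degree_mul_lazyWalkMatrix_symm G α hG u w
    rw [hd u, hd w] at this
    have hd0 : (d : ℝ) ≠ 0 := by
      have := hG u; rw [hd u] at this; exact_mod_cast this.ne'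
    exact mul_left_cancel₀ hd0 this
  have hcol : ∀ w, ∑ u, lazyWalkMatrix G α u w = 1 := by
    intro w
    have := congrFun (lazyWalkMatrix_mulVec_one G α hG) w
    simp only [Matrix.mulVec, dotProduct, mul_one] at this
    rw [← this]
    exact Finset.sum_congr rfl fun u _ => hsymm u w
  induction s with
  | zero => simp [Matrix.one_apply]
  | succ s ih =>
    simp only [pow_succ', Matrix.mul_apply]
    rw [Finset.sum_comm]
    simp only [← Finset.sum_mul, hcol, one_mul, ih]

theorem one_sub_sum_le_probAfter (G : SimpleGraph V) [DecidableRel G.Adj] (T : V → ℕ) {α : ℝ}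
    (h0 : 0 ≤ α) (h1 : α ≤ 1) (hG : ∀ v, 0 < G.degree v) (a : Fin m → V) (t : ℕ) (K : V → ℝ) :
    1 - ∑ v, ∑ b with ¬ (nodePotential T b v : ℝ) ≤ K v, (roundMatrix m G T α ^ t) a b
      ≤ probAfter G T α a t {b | ∀ v, (nodePotential T b v : ℝ) ≤ K v} := by
  classical
  have hQ := roundMatrix_pow_nonneg G T h0 h1 t a
  unfold probAfter
  rw [sub_le_iff_le_add, ← roundMatrix_pow_row_sum G T α hG t a]
  simp only [Finset.sum_filter]
  rw [Finset.sum_comm, ← Finset.sum_add_distrib]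
  refine Finset.sum_le_sum fun b _ => ?_
  have hnn : ∀ v, 0 ≤ if ¬ (nodePotential T b v : ℝ) ≤ K v then
      (roundMatrix m G T α ^ t) a b else 0 := by
    intro v; split_ifs <;> simp [hQ b]
  by_cases hb : ∀ v, (nodePotential T b v : ℝ) ≤ K v
  · rw [if_pos (by exact hb)]
    exact le_add_of_nonneg_right (Finset.sum_nonneg fun v _ => hnn v)
  · rw [if_neg (by exact hb), zero_add]
    push Not at hb
    obtain ⟨v, hv⟩ := hb
    refine le_trans ?_ (Finset.single_le_sum (fun v _ => hnn v) (Finset.mem_univ v))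
    rw [if_pos (not_le.2 hv)]

/-- Load bound after the mixing time, where `r` bounds the column sums of the powers of the walk
matrix. -/
theorem probAfter_mixingTime_ge (G : SimpleGraph V) [DecidableRel G.Adj] (T : V → ℕ) {α : ℝ}
    (h0 : 0 < α) (h1 : α ≤ 1 / 2) (hG : ∀ v, 0 < G.degree v) (hconn : G.Connected)
    (hcard : 2 ≤ Fintype.card V) (a : Fin m → V) {r : ℝ} (hr : 1 ≤ r)
    (hcol : ∀ s v, ∑ u, (lazyWalkMatrix G α ^ s) u v ≤ r) (M : V → ℝ)
    (hM : ∀ v, M v = (potential T a : ℝ) * (stationary G v + 1 / (Fintype.card V : ℝ) ^ 3)) :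
    1 - 1 / (Fintype.card V : ℝ) ≤ probAfter G T α a ⌈mixingTime G α⌉₊ {b | ∀ v,
      (nodePotential T b v : ℝ) ≤ M v + deviation (Fintype.card V) (M v)
        + 294 / (1 - α) * r * Real.log (Fintype.card V) ^ 2 * mixingTime G α ^ 2} := by
  have : Nonempty V := hconn.nonempty
  have hα1 : α ≤ 1 := by linarith
  refine le_trans (sub_le_sub_left ?_ 1) (one_sub_sum_le_probAfter G T h0.le hα1 hG a _ _)
  set n : ℝ := (Fintype.card V : ℝ) with hn
  set t := ⌈mixingTime G α⌉₊
  set X := mixingTime G α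
  set l := Real.log n
  set R := 294 / (1 - α) * r * l ^ 2 * X ^ 2 with hR
  have hn2 : (2 : ℝ) ≤ n := by rw [hn]; exact_mod_cast hcard
  have hl : 0.69 ≤ l := by
    have := Real.log_two_gt_d9
    have := Real.log_le_log two_pos hn2
    linarith
  have hX : 4 * l ≤ X := mixingTime_ge G α
  have htX : (t : ℝ) ≤ X + 1 := (Nat.ceil_lt_add_one (by linarith)).le
  -- From `4l ≤ X` and `1 ≤ X`, the left side is at most `52 r X`, while `X ≤ l² X²`; so the
  -- constant 294 is ample.
  have hRlow : r * t + 200 * l ≤ 9 / 10 * R := by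
    have e1 : 294 * (r * (l ^ 2 * X ^ 2)) ≤ R := by
      have h294 : 294 ≤ 294 / (1 - α) := by
        rw [le_div_iff₀ (by linarith)]; nlinarith
      have := mul_le_mul_of_nonneg_right h294 (show 0 ≤ r * (l ^ 2 * X ^ 2) by positivity)
      rw [hR]; linarith
    have e2 : 1 ≤ l ^ 2 * X := by nlinarith
    have e3 : X ≤ l ^ 2 * X ^ 2 := by nlinarith
    have e4 : r * X ≤ r * (l ^ 2 * X ^ 2) := mul_le_mul_of_nonneg_left e3 (by linarith)
    have e5 : r * t ≤ r * (X + 1) := mul_le_mul_of_nonneg_left htX (by linarith)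
    nlinarith
  have hnode : ∀ v, ∑ b with ¬ (nodePotential T b v : ℝ) ≤
      M v + deviation (Fintype.card V) (M v) + R, (roundMatrix m G T α ^ t) a b ≤ 1 / n ^ 2 := by
    intro v
    have hπ : 0 ≤ stationary G v := by unfold stationary; positivity
    have hM0 : 0 ≤ M v := by rw [hM]; positivity
    have hd1 : 8 * Real.sqrt (2 * M v * l) ≤ deviation (Fintype.card V) (M v) :=
      mul_le_mul_of_nonneg_left (le_max_left _ _) (by norm_num)
    obtain ⟨c, c0, c1, hc⟩ := exists_exponent (by linarith) hM0 hd1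
      ((by positivity : (0 : ℝ) ≤ 8 * Real.sqrt (2 * M v * l)).trans hd1)
      (show 0 ≤ r * t by positivity) hRlow
    refine (sum_roundMatrix_pow_tail_le G T h0.le h1 hG a t v c0 c1 (M := M v) (τ := r * t)
      ?_ ?_).trans ?_
    · rw [hM, potential]
      push_cast
      rw [Finset.sum_mul]
      refine Finset.sum_le_sum fun u _ => ?_
      rw [mul_comm]
      exact mul_le_mul_of_nonneg_left
        (lazyWalkMatrix_pow_mixingTime_le G h0 h1 hG hconn hcard u v) (Nat.cast_nonneg _)
    · refine (Finset.sum_le_sum fun s _ => hcol s v).trans (le_of_eq ?_)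
      rw [Finset.sum_const, Finset.card_range, nsmul_eq_mul, mul_comm]
    · refine (Real.exp_le_exp.2 hc).trans (le_of_eq ?_)
      rw [Real.exp_neg, show (2 : ℝ) * l = ((2 : ℕ) : ℝ) * l by norm_num, Real.exp_nat_mul,
        Real.exp_log (by linarith), one_div]
  refine (Finset.sum_le_sum fun v _ => hnode v).trans (le_of_eq ?_)
  rw [Finset.sum_const, nsmul_eq_mul, Finset.card_univ, ← hn]
  field_simp

end Tail

end ThresholdBalancing

/-! ### The two load bounds -/

open ThresholdBalancing
theorem theorem7 {V : Type*} [Fintype V] [DecidableEq V] (G : SimpleGraph V) [DecidableRel G.Adj]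
    (hconn : G.Connected) (hnb : ¬ G.IsBipartite) (n : ℕ) (hn : n = Fintype.card V)
    (m : ℕ) (T : V → ℕ) (α : ℝ) (hα0 : 0 < α) (hα1 : α ≤ 1 / 2) (a₀ : Fin m → V) :
    ((∃ d, G.IsRegularOfDegree d) →
      1 - 3 / (n : ℝ) ≤ probAfter G T α a₀ ⌈mixingTime G α⌉₊ {a | ∀ v,
        (nodePotential T a v : ℝ) ≤
          (potential T a₀ : ℝ) / n * (1 + 1 / (n : ℝ) ^ 2)
          + deviation n ((potential T a₀ : ℝ) / n * (1 + 1 / (n : ℝ) ^ 2))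
          + 294 / (1 - α) * Real.log n ^ 2 * mixingTime G α ^ 2}) ∧
    1 - 2 / (n : ℝ) ≤ probAfter G T α a₀ ⌈mixingTime G α⌉₊ {a | ∀ v,
        (nodePotential T a v : ℝ) ≤
          (potential T a₀ : ℝ) * (stationary G v + 1 / (n : ℝ) ^ 3)
          + deviation n ((potential T a₀ : ℝ) * (stationary G v + 1 / (n : ℝ) ^ 3))
          + 294 / (1 - α) * n * Real.log n ^ 2 * mixingTime G α ^ 2} := by
  subst hn
  have hne : Nonempty V := hconn.nonempty
  have hcard : 2 ≤ Fintype.card V := by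
    -- A graph with one vertex is bipartite.
    by_contra! h
    have : Subsingleton V := Fintype.card_le_one_iff_subsingleton.1 (by omega)
    exact hnb ⟨SimpleGraph.Coloring.mk (fun _ => 0) fun {u v} h =>
      (h.ne (Subsingleton.elim u v)).elim⟩
  have : Nontrivial V := Fintype.one_lt_card_iff_nontrivial.1 (by omega)
  have hG : ∀ v, 0 < G.degree v := fun v => hconn.preconnected.degree_pos_of_nontrivial v
  have hn1 : (1 : ℝ) ≤ Fintype.card V := by exact_mod_cast (by omega : 1 ≤ Fintype.card V)
  have hn0 : (0 : ℝ) < Fintype.card V := by linarith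
  have hinv : 0 ≤ 1 / (Fintype.card V : ℝ) := by positivity
  have h3 : 3 / (Fintype.card V : ℝ) = 3 * (1 / Fintype.card V) := by ring
  have h2 : 2 / (Fintype.card V : ℝ) = 2 * (1 / Fintype.card V) := by ring
  constructor
  · rintro ⟨d, hd⟩
    have hπ : ∀ v, stationary G v = 1 / (Fintype.card V : ℝ) := by
      intro v
      have hd0 : (d : ℝ) ≠ 0 := by
        have := hG v; rw [hd v] at this; exact_mod_cast this.ne'
      rw [stationary, ← sum_degree_eq]
      simp only [hd.degree_eq, Finset.sum_const, nsmul_eq_mul, Finset.card_univ]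
      field_simp
    have := probAfter_mixingTime_ge G T hα0 hα1 hG hconn hcard a₀ le_rfl
      (fun s v => (lazyWalkMatrix_pow_col_sum G α hd hG s v).le)
      (fun _ => (potential T a₀ : ℝ) / Fintype.card V * (1 + 1 / (Fintype.card V : ℝ) ^ 2))
      (fun v => by rw [hπ]; field_simp)
    simp only [mul_one] at this
    linarith
  -- Entries of the powers are at most 1, so column sums are at most `n`; this is the extra factor
  -- `n`.
  · have := probAfter_mixingTime_ge G T hα0 hα1 hG hconn hcard a₀ hn1
      (fun s v => (Finset.sum_le_sum fun u _ =>
        (lazyWalkMatrix_pow_entry_mem G hα0.le (by linarith) hG s u v).2).trans (by simp))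
      _ (fun _ => rfl)
    linarith
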